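/- **Corollary 3.2 (Zero-one Law).** Let $d\ge 2$. Let $\mathbb P_p$ be the law of Bernoulli bond percolation on $\mathbb Z^d$ with parameter $p\in[0,1]$: each nearest-neighbour edge is open with probability $p$, independently of the others; an environment $\omega$ records which edges are open. Let $\mathcal C=\mathcal C(\omega)$ be the set of vertices whose open cluster is infinite, let $p_c=p_c(d)=\sup\{p\in[0,1]:\mathbb P_p(0\in\mathcal C)=0\}$, and fix $p>p_c$ (then almost surely $\mathcal C$ is the unique infinite open cluster). Let $\tilde{\mathbb P}_p=\mathbb P_p(\,\cdot\mid 0\in\mathcal C)$. For an environment $\omega$ and $x\in\mathbb Z^d$, let $\mathbb P_\omega^x$ be the law of the blind random walk $(Y_n)_{n\ge0}$ in $\omega$ started at $x$: $Y_0=x$, and at each unit of time the walk chooses one of the $2d$ neighbours in $\mathbb Z^d$ of its current position uniformly at random, independently of the past, moves there if the edge leading to it is open in $\omega$, and stays where it is otherwise. Write $|y|=\sum_{j=1}^d|y_j|$ and $\Phi(n)=\sqrt{n\log\log n}$. For every real $a\ge 0$, the set of environments $$B_a=\Big\{\omega:\ \text{for all }x\in\mathcal C(\omega),\ \ \mathbb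 P_\omega^x\Big(\limsup_{n\to\infty}\frac{|Y_n|}{\Phi(n)}>a\Big)=1\Big\}$$ (with the $\limsup$ taken in $[0,\infty]$) is measurable, and $\mathbb P_p(B_a)\in\{0,1\}$ and $\tilde{\mathbb P}_p(B_a)\in\{0,1\}$. -/

import Mathlib

open MeasureTheory ProbabilityTheory Filter

noncomputable section

namespace Percolation

/-- The vertex set `ℤ^d`. -/
abbrev Vertex (d : ℕ) : Type := Fin d → ℤ

/-- The nearest-neighbour edges of `ℤ^d`: the pair `(x, i)` stands for the undirected edge between
`x` and `x + e_i`, and every edge is represented by exactly one such pair. -/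
abbrev Edge (d : ℕ) : Type := Vertex d × Fin d

/-- A percolation environment; an edge is open when its value is `true`. -/
abbrev Env (d : ℕ) : Type := Edge d → Bool

/-- The `i`-th coordinate vector `e_i` of `ℤ^d`. -/
def unitVec {d : ℕ} (i : Fin d) : Vertex d := Pi.single i 1

/-- Bernoulli bond percolation `ℙ_p` on `ℤ^d`: the edges are independently open with
probability `p`. -/
def percolation (d : ℕ) (p : unitInterval) : Measure (Env d) :=
  Measure.infinitePi fun _ : Edge d => bernoulliMeasure true false p

/-- The graph on `ℤ^d` whose edges are the open edges of `ω`. -/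
def openGraph {d : ℕ} (ω : Env d) : SimpleGraph (Vertex d) :=
  SimpleGraph.fromRel fun x y => ∃ i : Fin d, y = x + unitVec i ∧ ω (x, i) = true

/-- The set of the vertices whose open cluster (connected component in the open graph) is infinite.
For `p > p_c` there is almost surely exactly one infinite open cluster, and this set is it. -/
def infiniteCluster {d : ℕ} (ω : Env d) : Set (Vertex d) :=
  {x | {y | (openGraph ω).Reachable x y}.Infinite}

/-- The critical probability `p_c(d) = sup {p ∈ [0,1] : ℙ_p(0 is in an infinite cluster) = 0}`. -/
def criticalProb (d : ℕ) : unitInterval :=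
  sSup {p | percolation d p {ω | (0 : Vertex d) ∈ infiniteCluster ω} = 0}

/-- `ℙ_p` conditioned on the event that the origin belongs to the infinite cluster. -/
def percolationCond (d : ℕ) (p : unitInterval) : Measure (Env d) :=
  ProbabilityTheory.cond (percolation d p) {ω | (0 : Vertex d) ∈ infiniteCluster ω}

/-- The `2d` unit steps of `ℤ^d`: `(i, true)` is `e_i` and `(i, false)` is `-e_i`. -/
abbrev Dir (d : ℕ) : Type := Fin d × Bool

/-- The vector of a unit step. -/
def Dir.toVec {d : ℕ} (s : Dir d) : Vertex d := if s.2 then unitVec s.1 else -unitVec s.1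

open Classical in
/-- The blind walk in the environment `ω`, started at `x`, that tries the steps
`s 0, s 1, s 2, …`: at each unit of time it moves to the proposed neighbour if the edge leading
there is open, and stays where it is otherwise. -/
def blindWalk {d : ℕ} (ω : Env d) (x : Vertex d) (s : ℕ → Dir d) : ℕ → Vertex d
  | 0 => x
  | n + 1 =>
    if (openGraph ω).Adj (blindWalk ω x s n) (blindWalk ω x s n + (s n).toVec) then
      blindWalk ω x s n + (s n).toVec
    else blindWalk ω x s n

/-- The law of an i.i.d. sequence of uniformly chosen unit steps. -/
def stepLaw (d : ℕ) : Measure (ℕ → Dir d) :=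
  Measure.infinitePi fun _ : ℕ => uniformOn (Set.univ : Set (Dir d))

/-- The law `ℙ_ω^x`, on the space of trajectories, of the blind walk in `ω` started at `x`. -/
def blindWalkLaw {d : ℕ} (ω : Env d) (x : Vertex d) : Measure (ℕ → Vertex d) :=
  (stepLaw d).map (blindWalk ω x)

/-- The norm `|x|_1` on `ℤ^d`. -/
def l1Norm {d : ℕ} (x : Vertex d) : ℝ := ∑ i, |(x i : ℝ)|

/-- `Φ(t) = √(t log log t)`. Only the values at large `t` matter. -/
def Phi (t : ℝ) : ℝ := Real.sqrt (t * Real.log (Real.log t))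

/-- The event `limsup_n |Y_n|_1 / Φ(n) > a` in the space of trajectories; the upper limit is taken
in the extended reals, so that it may be `+∞`. -/
def limsupEvent (d : ℕ) (a : ℝ) : Set (ℕ → Vertex d) :=
  {Y | (a : EReal) < limsup (fun n : ℕ => ((l1Norm (Y n) / Phi n : ℝ) : EReal)) atTop}

/-- The event `B_a`: for every `x` in the infinite cluster, the walk started at `x` satisfies
`limsup_n |Y_n|_1 / Φ(n) > a` almost surely. -/
def zeroOneEvent (d : ℕ) (a : ℝ) : Set (Env d) :=
  {ω | ∀ x ∈ infiniteCluster ω, ∀ᵐ Y ∂(blindWalkLaw ω x), Y ∈ limsupEvent d a}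

end Percolation

end

/-! The event is invariant under translations of the lattice: shifting the environment by `z` shifts
the walk driven by the same steps, and this changes the norm by at most `l1Norm z`, which is
negligible against `Phi n → ∞` (`limsup_translate_le`). Invariant events of a product measure are
trivial: approximate `A` by a cylinder `C` and translate `C` off its own support; the two copies are
independent and both close to `A`, so `P A = (P A)²`. The conditional law is absolutely continuous
with respect to `percolation d p`, so null and full events stay null and full; `p > p_c` makes the
conditioning event non-null. -/

open scoped symmDiff in
/-- An event of an i.i.d. family which is invariant under reindexings that move every finite index
set off itself has probability zero or one. -/
theorem MeasureTheory.Measure.infinitePi_eq_zero_or_one_of_invariant {ι X : Type*}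
    [MeasurableSpace X] (μ : Measure X) [IsProbabilityMeasure μ] {A : Set (ι → X)}
    (hA : MeasurableSet A)
    (h : ∀ S : Finset ι, ∃ e : ι ≃ ι, Disjoint S (S.map e.toEmbedding) ∧
      (fun (ω : ι → X) i => ω (e i)) ⁻¹' A = A) :
    Measure.infinitePi (fun _ : ι => μ) A = 0 ∨ Measure.infinitePi (fun _ : ι => μ) A = 1 := by
  set P := Measure.infinitePi (fun _ : ι => μ) with hP
  -- Of the `4 * ε`, half comes from replacing `A` by `C ∩ T ⁻¹' C`, half from replacing `(P C)²` by
  -- `(P A)²`.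
  have key : ∀ ε : ℝ, 0 < ε → |P.real A - P.real A * P.real A| ≤ 4 * ε := by
    intro ε hε
    obtain ⟨C, hC, hCA⟩ := (Measure.MeasureDense.of_generateFrom_isSetAlgebra_finite (μ := P)
      (isSetAlgebra_measurableCylinders (α := fun _ : ι => X))
      generateFrom_measurableCylinders.symm).approx A hA (measure_ne_top P A) ε hε
    have hCm : MeasurableSet C := MeasurableSet.of_mem_measurableCylinders hC
    obtain ⟨S, C₀, hC₀, rfl⟩ := (mem_measurableCylinders C).1 hC
    obtain ⟨e, hdisj, hinv⟩ := h S
    set T : (ι → X) → (ι → X) := fun ω i => ω (e i) with hT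
    have hTm : Measurable T := by fun_prop
    have hTP : MeasurePreserving T P P := by
      refine ⟨hTm, ?_⟩
      have := Measure.infinitePi_map_piCongrLeft (X := fun _ : ι => X) (μ := fun _ : ι => μ) e.symm
      rw [hP]
      convert this using 2
      ext ω i
      obtain ⟨j, rfl⟩ := e.symm.surjective i
      simp [hT, MeasurableEquiv.coe_piCongrLeft, Equiv.piCongrLeft_apply]
    set C : Set (ι → X) := cylinder S C₀
    have h1 : P.real (A ∆ C) ≤ ε := by
      rw [Measure.real]
      exact ENNReal.toReal_le_of_le_ofReal hε.le hCA.le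
    have h2 : P.real (A ∆ (T ⁻¹' C)) ≤ ε := by
      have : A ∆ (T ⁻¹' C) = T ⁻¹' (A ∆ C) := by
        conv_lhs => rw [← hinv]
        rfl
      rw [this, Measure.real, hTP.measure_preimage (hA.symmDiff hCm).nullMeasurableSet]
      exact h1
    have hTC : P.real (T ⁻¹' C) = P.real C := by
      rw [Measure.real, hTP.measure_preimage hCm.nullMeasurableSet, Measure.real]
    have h3 : P.real (C ∩ T ⁻¹' C) = P.real C * P.real C := by
      have hind := (iIndepFun_infinitePi (P := fun _ : ι => μ) (X := fun _ => id)
        (fun _ => measurable_id)).indepFun_finset S (S.map e.toEmbedding) hdisj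
        (fun i => measurable_pi_apply i)
      have hg : Measurable fun (g : (S.map e.toEmbedding) → X) (i : S) =>
          g ⟨e i, Finset.mem_map_of_mem e.toEmbedding i.2⟩ := by fun_prop
      have := hind.measure_inter_preimage_eq_mul C₀ _ hC₀ (hg hC₀)
      have h4 : P (C ∩ T ⁻¹' C) = P C * P (T ⁻¹' C) := this
      rw [Measure.real, h4, ENNReal.toReal_mul]
      exact congrArg (P.real C * ·) hTC
    have h5 : |P.real A - P.real (C ∩ T ⁻¹' C)| ≤ 2 * ε := by
      refine (abs_measureReal_sub_le_measureReal_symmDiff hA.nullMeasurableSet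
        (hCm.inter (hTm hCm)).nullMeasurableSet).trans ?_
      have hsub : A ∆ (C ∩ T ⁻¹' C) ⊆ A ∆ C ∪ A ∆ (T ⁻¹' C) := by
        intro ω
        simp only [Set.mem_symmDiff, Set.mem_inter_iff, Set.mem_union]
        tauto
      linarith [measureReal_mono hsub (μ := P), measureReal_union_le (μ := P) (A ∆ C) (A ∆ (T ⁻¹' C))]
    have h6 : |P.real A - P.real C| ≤ ε :=
      (abs_measureReal_sub_le_measureReal_symmDiff hA.nullMeasurableSet
        hCm.nullMeasurableSet).trans h1
    have hA0 := measureReal_nonneg (μ := P) (s := A)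
    have hA1 := measureReal_le_one (μ := P) (s := A)
    have hC0 := measureReal_nonneg (μ := P) (s := C)
    have hC1 := measureReal_le_one (μ := P) (s := C)
    rw [h3] at h5
    rw [abs_le] at h5 h6 ⊢
    constructor <;> nlinarith
  have hzero : P.real A - P.real A * P.real A = 0 := by
    refine abs_eq_zero.1 (le_antisymm (le_of_forall_pos_le_add fun ε hε => ?_) (abs_nonneg _))
    linarith [key (ε / 4) (by positivity)]
  have hfac : P.real A * (1 - P.real A) = 0 := by linarith
  rcases mul_eq_zero.1 hfac with h0 | h0
  · exact Or.inl ((measureReal_eq_zero_iff).1 h0)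
  · right
    rw [← ENNReal.toReal_eq_one_iff]
    change P.real A = 1
    linarith

namespace Percolation

variable {d : ℕ}

/-! ### Measurability of the event -/

section Measurability

theorem measurableSet_adj (x y : Vertex d) :
    MeasurableSet {ω : Env d | (openGraph ω).Adj x y} := by
  simp only [openGraph, SimpleGraph.fromRel_adj]
  have h : ∀ e : Edge d, MeasurableSet {ω : Env d | ω e = true} := fun e =>
    (measurable_pi_apply e : Measurable fun ω : Env d => ω e) (measurableSet_singleton true)
  have h' : ∀ x y : Vertex d,
      MeasurableSet {ω : Env d | ∃ i : Fin d, y = x + unitVec i ∧ ω (x, i) = true} := by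
    intro x y
    rw [Set.ofPred_exists]
    exact MeasurableSet.iUnion fun i => (MeasurableSet.const _).inter (h _)
  exact (MeasurableSet.const _).inter ((h' x y).union (h' y x))

theorem measurableSet_reachable (x y : Vertex d) :
    MeasurableSet {ω : Env d | (openGraph ω).Reachable x y} := by
  have hwalk : ∀ n (x : Vertex d),
      MeasurableSet {ω : Env d | ∃ w : (openGraph ω).Walk x y, w.length = n} := by
    intro n
    induction n with
    | zero =>
      intro x
      simp only [SimpleGraph.Walk.exists_length_eq_zero_iff]
      exact MeasurableSet.const _
    | succ n ih =>
      intro x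
      have : {ω : Env d | ∃ w : (openGraph ω).Walk x y, w.length = n + 1} =
          ⋃ z, {ω : Env d | (openGraph ω).Adj x z} ∩
            {ω | ∃ w : (openGraph ω).Walk z y, w.length = n} := by
        ext ω
        simp only [Set.mem_ofPred_eq, Set.mem_iUnion, Set.mem_inter_iff]
        constructor
        · rintro ⟨w, hw⟩
          cases w with
          | nil => simp at hw
          | cons hadj w => exact ⟨_, hadj, w, by simpa using hw⟩
        · rintro ⟨z, hadj, w, hw⟩
          exact ⟨.cons hadj w, by simp [hw]⟩
      rw [this]
      exact MeasurableSet.iUnion fun z => (measurableSet_adj x z).inter (ih z)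
  have : {ω : Env d | (openGraph ω).Reachable x y} =
      ⋃ n, {ω : Env d | ∃ w : (openGraph ω).Walk x y, w.length = n} := by
    ext ω
    simp only [Set.mem_ofPred_eq, Set.mem_iUnion]
    exact ⟨fun ⟨w⟩ => ⟨_, w, rfl⟩, fun ⟨_, w, _⟩ => ⟨w⟩⟩
  rw [this]
  exact MeasurableSet.iUnion fun n => hwalk n x

theorem measurableSet_mem_infiniteCluster (x : Vertex d) :
    MeasurableSet {ω : Env d | x ∈ infiniteCluster ω} := by
  have : {ω : Env d | x ∈ infiniteCluster ω} =
      -- A set is infinite iff it leaves every finite set, and there are only countably many of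
      -- these.
      ⋂ F : Finset (Vertex d), ⋃ y ∈ {y | y ∉ F}, {ω : Env d | (openGraph ω).Reachable x y} := by
    ext ω
    simp only [infiniteCluster, Set.mem_ofPred_eq, Set.mem_iInter, Set.mem_iUnion, exists_prop]
    constructor
    · intro h F
      obtain ⟨y, hy, hyF⟩ := h.exists_notMem_finset F
      exact ⟨y, hyF, hy⟩
    · intro h hfin
      obtain ⟨y, hyF, hy⟩ := h hfin.toFinset
      exact hyF (hfin.mem_toFinset.2 hy)
  rw [this]
  exact MeasurableSet.iInter fun F => MeasurableSet.biUnion (Set.to_countable _)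
    fun y _ => measurableSet_reachable x y

theorem measurable_blindWalk_apply (x : Vertex d) (n : ℕ) :
    Measurable fun q : Env d × (ℕ → Dir d) => blindWalk q.1 x q.2 n := by
  induction n with
  | zero => exact measurable_const
  | succ n ih =>
    have hs : Measurable fun q : Env d × (ℕ → Dir d) => q.2 n := by fun_prop
    have htry : Measurable fun q : Env d × (ℕ → Dir d) =>
        blindWalk q.1 x q.2 n + (q.2 n).toVec :=
      (measurable_of_countable fun v : Vertex d × Dir d => v.1 + v.2.toVec).comp (ih.prodMk hs)
    refine Measurable.ite ?_ htry ih
    have : {q : Env d × (ℕ → Dir d) | (openGraph q.1).Adj (blindWalk q.1 x q.2 n)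
          (blindWalk q.1 x q.2 n + (q.2 n).toVec)} =
        ⋃ y, ⋃ z, (fun q => blindWalk q.1 x q.2 n) ⁻¹' {y} ∩
          (fun q => blindWalk q.1 x q.2 n + (q.2 n).toVec) ⁻¹' {z} ∩
          Prod.fst ⁻¹' {ω : Env d | (openGraph ω).Adj y z} := by
      ext q
      simp
    rw [this]
    exact MeasurableSet.iUnion fun y => MeasurableSet.iUnion fun z =>
      ((ih (measurableSet_singleton y)).inter (htry (measurableSet_singleton z))).inter
        (measurable_fst (measurableSet_adj y z))

theorem measurable_blindWalk_uncurry (x : Vertex d) :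
    Measurable fun q : Env d × (ℕ → Dir d) => blindWalk q.1 x q.2 :=
  measurable_pi_lambda _ fun n => measurable_blindWalk_apply x n

theorem measurable_blindWalk (ω : Env d) (x : Vertex d) : Measurable (blindWalk ω x) :=
  (measurable_blindWalk_uncurry x).comp measurable_prodMk_left

theorem measurableSet_limsupEvent (d : ℕ) (a : ℝ) : MeasurableSet (limsupEvent d a) := by
  refine measurableSet_lt measurable_const (Measurable.limsup fun n => ?_)
  exact (measurable_of_countable fun y : Vertex d =>
    ((l1Norm y / Phi n : ℝ) : EReal)).comp (measurable_pi_apply n)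

theorem ae_blindWalkLaw_iff {a : ℝ} (ω : Env d) (x : Vertex d) :
    (∀ᵐ Y ∂(blindWalkLaw ω x), Y ∈ limsupEvent d a) ↔
      ∀ᵐ s ∂(stepLaw d), blindWalk ω x s ∈ limsupEvent d a :=
  ae_map_iff (measurable_blindWalk ω x).aemeasurable (measurableSet_limsupEvent d a)

theorem isProbabilityMeasure_stepLaw [NeZero d] : IsProbabilityMeasure (stepLaw d) := by
  unfold stepLaw
  infer_instance

theorem measurableSet_zeroOneEvent [NeZero d] (a : ℝ) : MeasurableSet (zeroOneEvent d a) := by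
  have := isProbabilityMeasure_stepLaw (d := d)
  have hae : ∀ x, MeasurableSet {ω : Env d | ∀ᵐ Y ∂(blindWalkLaw ω x), Y ∈ limsupEvent d a} := by
    intro x
    simp only [ae_blindWalkLaw_iff]
    -- The steps have a law free of `ω`, so the exceptional probability is the measure of a section
    -- of a jointly measurable set.
    exact measurable_measure_prodMk_left (ν := stepLaw d)
      ((measurable_blindWalk_uncurry x) (measurableSet_limsupEvent d a)).compl
      (measurableSet_singleton 0)
  have : zeroOneEvent d a = ⋂ x, ({ω : Env d | x ∈ infiniteCluster ω}ᶜ ∪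
      {ω : Env d | ∀ᵐ Y ∂(blindWalkLaw ω x), Y ∈ limsupEvent d a}) := by
    ext ω
    simp [zeroOneEvent, imp_iff_not_or]
  rw [this]
  exact MeasurableSet.iInter fun x => (measurableSet_mem_infiniteCluster x).compl.union (hae x)

end Measurability

/-! ### Translation invariance -/

section Translation

/-- The translation of the edges of `ℤ^d` by the vector `z`. -/
def shiftEdge (z : Vertex d) : Edge d ≃ Edge d := (Equiv.addRight z).prodCongr (Equiv.refl _)

/-- The environment `ω` seen from the vertex `z`. -/
def shiftEnv (z : Vertex d) (ω : Env d) : Env d := fun e => ω (shiftEdge z e)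

theorem openGraph_shiftEnv (z : Vertex d) (ω : Env d) :
    openGraph (shiftEnv z ω) = (openGraph ω).comap (Equiv.addRight z) := by
  ext x y
  have h : ∀ u v w : Vertex d, u + z = v + z + w ↔ u = v + w := fun u v w => by
    rw [add_right_comm, add_left_inj]
  simp [openGraph, shiftEnv, shiftEdge, h]

theorem adj_shiftEnv (z : Vertex d) (ω : Env d) (x y : Vertex d) :
    (openGraph (shiftEnv z ω)).Adj x y ↔ (openGraph ω).Adj (x + z) (y + z) := by
  rw [openGraph_shiftEnv]
  rfl

theorem reachable_shiftEnv (z : Vertex d) (ω : Env d) (x y : Vertex d) :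
    (openGraph (shiftEnv z ω)).Reachable x y ↔ (openGraph ω).Reachable (x + z) (y + z) := by
  rw [openGraph_shiftEnv]
  exact (SimpleGraph.Iso.reachable_iff (φ := SimpleGraph.Iso.comap (Equiv.addRight z) _)).symm

theorem mem_infiniteCluster_shiftEnv (z : Vertex d) (ω : Env d) (x : Vertex d) :
    x ∈ infiniteCluster (shiftEnv z ω) ↔ x + z ∈ infiniteCluster ω := by
  have : {y | (openGraph (shiftEnv z ω)).Reachable x y} =
      Equiv.addRight z ⁻¹' {y | (openGraph ω).Reachable (x + z) y} := by
    ext y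
    exact reachable_shiftEnv z ω x y
  simp only [infiniteCluster, Set.mem_ofPred_eq, this]
  rw [← Set.infinite_image_iff (Equiv.addRight z).injective.injOn, Equiv.image_preimage]

theorem blindWalk_shiftEnv (z : Vertex d) (ω : Env d) (x : Vertex d) (s : ℕ → Dir d) (n : ℕ) :
    blindWalk ω (x + z) s n = blindWalk (shiftEnv z ω) x s n + z := by
  induction n with
  | zero => rfl
  | succ n ih =>
    have hadj : (openGraph ω).Adj (blindWalk ω (x + z) s n)
          (blindWalk ω (x + z) s n + (s n).toVec) ↔
        (openGraph (shiftEnv z ω)).Adj (blindWalk (shiftEnv z ω) x s n)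
          (blindWalk (shiftEnv z ω) x s n + (s n).toVec) := by
      rw [adj_shiftEnv, ih, add_right_comm]
    simp only [blindWalk]
    split_ifs with h h' h'
    · rw [ih, add_right_comm]
    · exact absurd (hadj.1 h) h'
    · exact absurd (hadj.2 h') h
    · exact ih

theorem l1Norm_add_le (x y : Vertex d) : l1Norm (x + y) ≤ l1Norm x + l1Norm y := by
  simp only [l1Norm, ← Finset.sum_add_distrib]
  exact Finset.sum_le_sum fun i _ => by simpa using abs_add_le (x i : ℝ) (y i : ℝ)

theorem tendsto_Phi_atTop : Tendsto (fun n : ℕ => Phi n) atTop atTop := by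
  refine Real.tendsto_sqrt_atTop.comp ?_
  exact Tendsto.atTop_mul_atTop₀ tendsto_natCast_atTop_atTop
    (Real.tendsto_log_atTop.comp (Real.tendsto_log_atTop.comp tendsto_natCast_atTop_atTop))

theorem limsup_translate_le (Y : ℕ → Vertex d) (z : Vertex d) :
    limsup (fun n : ℕ => ((l1Norm (Y n + z) / Phi n : ℝ) : EReal)) atTop ≤
      limsup (fun n : ℕ => ((l1Norm (Y n) / Phi n : ℝ) : EReal)) atTop := by
  have hz : limsup (fun n : ℕ => ((l1Norm z / Phi n : ℝ) : EReal)) atTop = 0 := by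
    refine Tendsto.limsup_eq ?_
    rw [← EReal.coe_zero]
    exact (continuous_coe_real_ereal.tendsto 0).comp
      (tendsto_const_nhds.div_atTop tendsto_Phi_atTop)
  calc _ ≤ limsup ((fun n : ℕ => ((l1Norm (Y n) / Phi n : ℝ) : EReal)) +
          fun n : ℕ => ((l1Norm z / Phi n : ℝ) : EReal)) atTop := by
        refine limsup_le_limsup (Eventually.of_forall fun n => ?_)
        simp only [Pi.add_apply, ← EReal.coe_add, ← add_div]
        exact EReal.coe_le_coe_iff.2
          (div_le_div_of_nonneg_right (l1Norm_add_le _ _) (Real.sqrt_nonneg _))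
    _ ≤ limsup (fun n : ℕ => ((l1Norm (Y n) / Phi n : ℝ) : EReal)) atTop +
          limsup (fun n : ℕ => ((l1Norm z / Phi n : ℝ) : EReal)) atTop :=
        -- The second upper limit is `0`, which excludes `⊤ + ⊥` even if the first is infinite.
        EReal.limsup_add_le (by simp [hz]) (by simp [hz])
    _ = _ := by rw [hz, add_zero]

theorem translate_mem_limsupEvent_iff {a : ℝ} (Y : ℕ → Vertex d) (z : Vertex d) :
    (fun n => Y n + z) ∈ limsupEvent d a ↔ Y ∈ limsupEvent d a := by
  have h := limsup_translate_le (fun n => Y n + z) (-z)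
  simp only [add_neg_cancel_right] at h
  exact ⟨fun hY => lt_of_lt_of_le hY (limsup_translate_le Y z), fun hY => lt_of_lt_of_le hY h⟩

theorem shiftEnv_mem_zeroOneEvent_iff {a : ℝ} (z : Vertex d) (ω : Env d) :
    shiftEnv z ω ∈ zeroOneEvent d a ↔ ω ∈ zeroOneEvent d a := by
  simp only [zeroOneEvent, Set.mem_ofPred_eq, ae_blindWalkLaw_iff]
  refine (Equiv.addRight z).forall_congr fun x => ?_
  rw [Equiv.coe_addRight, mem_infiniteCluster_shiftEnv]
  have : ∀ s, blindWalk ω (x + z) s = fun n => blindWalk (shiftEnv z ω) x s n + z :=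
    fun s => funext (blindWalk_shiftEnv z ω x s)
  simp only [this, translate_mem_limsupEvent_iff]

/-- Only the finitely many differences of base points of edges in `S` are bad choices of `z`, and
the lattice is infinite for `d ≠ 0`. -/
theorem exists_disjoint_shiftEdge [NeZero d] (S : Finset (Edge d)) :
    ∃ z : Vertex d, Disjoint S (S.map (shiftEdge z).toEmbedding) := by
  classical
  obtain ⟨z, hz⟩ := Infinite.exists_notMem_finset
    ((S ×ˢ S).image fun q : Edge d × Edge d => q.1.1 - q.2.1)
  refine ⟨z, Finset.disjoint_left.2 fun e he he' => hz ?_⟩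
  obtain ⟨e', he'S, rfl⟩ := Finset.mem_map.1 he'
  exact Finset.mem_image.2 ⟨(_, e'), Finset.mk_mem_product he he'S, by simp [shiftEdge]⟩

end Translation

theorem percolation_zeroOneEvent_eq_zero_or_one [NeZero d] (p : unitInterval) (a : ℝ) :
    percolation d p (zeroOneEvent d a) = 0 ∨ percolation d p (zeroOneEvent d a) = 1 := by
  refine Measure.infinitePi_eq_zero_or_one_of_invariant _ (measurableSet_zeroOneEvent a)
    fun S => ?_
  obtain ⟨z, hz⟩ := exists_disjoint_shiftEdge S
  exact ⟨shiftEdge z, hz, Set.ext fun ω => shiftEnv_mem_zeroOneEvent_iff z ω⟩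

theorem percolation_zero_mem_infiniteCluster_ne_zero {p : unitInterval}
    (hp : criticalProb d < p) :
    percolation d p {ω | (0 : Vertex d) ∈ infiniteCluster ω} ≠ 0 :=
  fun h => hp.not_ge (le_sSup h)

end Percolation

theorem corollary3p2 (d : ℕ) (hd : 2 ≤ d) (p : unitInterval)
    (hp : Percolation.criticalProb d < p) (a : ℝ) (ha : 0 ≤ a) :
    MeasurableSet (Percolation.zeroOneEvent d a) ∧
    (Percolation.percolation d p (Percolation.zeroOneEvent d a) = 0 ∨
      Percolation.percolation d p (Percolation.zeroOneEvent d a) = 1) ∧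
    (Percolation.percolationCond d p (Percolation.zeroOneEvent d a) = 0 ∨
      Percolation.percolationCond d p (Percolation.zeroOneEvent d a) = 1) := by
  have : NeZero d := ⟨by omega⟩
  have hmeas := Percolation.measurableSet_zeroOneEvent (d := d) a
  have h01 := Percolation.percolation_zeroOneEvent_eq_zero_or_one (d := d) p a
  have : IsProbabilityMeasure (Percolation.percolation d p) := by
    unfold Percolation.percolation
    infer_instance
  have hac : Percolation.percolationCond d p ≪ Percolation.percolation d p :=
    cond_absolutelyContinuous
  have : IsProbabilityMeasure (Percolation.percolationCond d p) :=
    cond_isProbabilityMeasure (Percolation.percolation_zero_mem_infiniteCluster_ne_zero hp)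
  refine ⟨hmeas, h01, h01.imp (fun h => hac h) fun h => ?_⟩
  -- Absolute continuity transfers null sets only, so pass to the complement.
  rw [← prob_compl_eq_zero_iff hmeas] at h ⊢
  exact hac h
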